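/- Theorem 2.2. Let $n\ge 0$ and let $M$ be an $n$-manifold, i.e. a second countable Hausdorff space in which every point has an open neighborhood homeomorphic to an open subset of $E^n$, where $E^n$ is $\mathbb{R}^n$ with its Euclidean topology (so $M$ has no boundary; it need be neither compact nor connected). Suppose that $\mathcal{G}$ is an upper semicontinuous decomposition of $M$ into points and a countable family of essentially flat arcs. Then the quotient space $M/\mathcal{G}$ is homeomorphic to $M$. Here a decomposition $\mathcal{G}$ of $M$ is a partition of $M$; it is upper semicontinuous if its elements are closed and for every $g\in\mathcal{G}$ and every open $U\supseteq g$ there is an open $V$ with $g\subseteq V\subseteq U$ such that every $g'\in\mathcal{G}$ which meets $V$ is contained in $U$. It is a decomposition into points and a countable family of essentially flat arcs if there is a countable (possibly empty or finite) family $\mathcal{A}$ of essentially flat arcs in $M$ such that every element of $\mathcal{G}$ is a one-point set or a member of $\mathcal{A}$. An arc is a subset homeomorphic to $[0,1]$. An arc $A\subseteq M$ is essentially flat if there are a neighborhood $U$ of $A$ in $M$ and a homeomorphism $\psi$ of $U$ onto $E^n$ such that $\psi(A)$ is flat, i.e. such that some homeomorphism of $E^n$ onto itself carries $\psi(A)$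 onto a nondegenerate straight line segment. -/

import Mathlib

/-- An arc: a subset which, with the subspace topology, is homeomorphic to `[0, 1]`. -/
def IsArc {X : Type*} [TopologicalSpace X] (A : Set X) : Prop :=
  Nonempty (A ≃ₜ Set.Icc (0 : ℝ) 1)

/-- A subset `B` of `Eⁿ` is a flat arc if some homeomorphism of `Eⁿ` onto itself carries it
onto a nondegenerate straight line segment. -/
def IsFlatArc {n : ℕ} (B : Set (EuclideanSpace ℝ (Fin n))) : Prop :=
  ∃ (θ : EuclideanSpace ℝ (Fin n) ≃ₜ EuclideanSpace ℝ (Fin n))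
    (a b : EuclideanSpace ℝ (Fin n)), a ≠ b ∧ θ '' B = segment ℝ a b

/-- An arc `A` in an `n`-manifold is essentially flat if there are a neighborhood `U` of `A`
and a homeomorphism `ψ` of `U` onto `Eⁿ` such that `ψ(A)` is flat. -/
def IsEssentiallyFlatArc (n : ℕ) {M : Type*} [TopologicalSpace M] (A : Set M) : Prop :=
  IsArc A ∧ ∃ U : Set M, (∃ O : Set M, IsOpen O ∧ A ⊆ O ∧ O ⊆ U) ∧
    ∃ ψ : U ≃ₜ EuclideanSpace ℝ (Fin n), IsFlatArc (ψ '' {x : U | (x : M) ∈ A})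

/-- A decomposition (partition) of a space, encoded by the equivalence relation whose classes
are its elements, is upper semicontinuous if its elements are closed and, for every element `g`
and every open `U ⊇ g`, there is an open `V` with `g ⊆ V ⊆ U` such that every element
which meets `V` lies in `U`. -/
def IsUpperSemicontinuousDecomposition {X : Type*} [TopologicalSpace X] (G : Setoid X) : Prop :=
  ∀ g ∈ G.classes, IsClosed g ∧ ∀ U : Set X, IsOpen U → g ⊆ U →
    ∃ V : Set X, IsOpen V ∧ g ⊆ V ∧ V ⊆ U ∧
      ∀ g' ∈ G.classes, (g' ∩ V).Nonempty → g' ⊆ U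

/-!
The theorem is an instance of R. H. Bing's shrinking technique. Let `π : M → Y` be the quotient map
onto the decomposition space. Upper semicontinuity says that `π` is closed; since its fibres are
compact, `Y` inherits from `M` that it is Hausdorff, second countable and locally compact, so that
`M` and `Y` carry complete metrics (`isCompletelyMetrizableSpace_of_locallyCompact`).

A homeomorphism `M ≃ₜ Y` is obtained as a uniform limit of maps `π ∘ h⁻¹`, with `h` a homeomorphism
of `M`. It suffices that each such map can be approximated by maps of the same kind whose fibres over
a prescribed compact set are small (`exists_homeomorph_of_dense_small_fibers`): along an exhaustion
of `Y` by compact sets, the approximations are made so fast that the small fibres stay small, and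
the limit is then injective with a continuous inverse.

To make all fibres over a compact set small, the countably many nondegenerate ones are shrunk in
turn (`HasShrinkableFibers.exists_homeomorph`). They need not form a null sequence, so shrinking one
of them must not enlarge the others by more than a summable error. Then the sets of points with a
small fibre form an increasing open cover, and compactness ends the process after finitely many
steps.

Shrinking one flat arc with this control is an explicit construction in the chart in which the arc
is a straight segment (`compress`, `exists_homeomorph_shrinking_segment`). The longitudinal
coordinate is cut off at a level which moves from one end of the segment almost to the other as the
distance from the segment decreases. By upper semicontinuity the level can be made to vary so slowly
that it is almost constant on each fibre (`exists_slow_transition`). On a connected fibre close to the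
segment, cutting off at a constant level moves each point close to another point of the same fibre
or collapses the fibre almost to a point (`dist_compress_le`), so no fibre is enlarged by much. This
is where connectedness of the fibres is used.
-/

/-! ### Complete metrizability of locally compact spaces -/

open Set Filter Topology in
/-- A locally compact metric space is open in its completion, hence Polish if it is separable. -/
theorem isCompletelyMetrizableSpace_of_locallyCompact (X : Type*) [TopologicalSpace X]
    [T2Space X] [LocallyCompactSpace X] [SecondCountableTopology X] :
    TopologicalSpace.IsCompletelyMetrizableSpace X := by
  let := TopologicalSpace.metrizableSpaceMetric X
  have hι : IsDenseInducing ((↑) : X → UniformSpace.Completion X) :=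
    UniformSpace.Completion.isDenseInducing_coe
  have hemb : IsEmbedding ((↑) : X → UniformSpace.Completion X) :=
    UniformSpace.Completion.isUniformEmbedding_coe X |>.isEmbedding
  have hopen : IsOpen (range ((↑) : X → UniformSpace.Completion X)) := by
    rw [isOpen_iff_mem_nhds]
    rintro _ ⟨x, rfl⟩
    obtain ⟨K, hK, hx⟩ := exists_compact_mem_nhds x
    rw [hι.nhds_eq_comap, mem_comap] at hx
    obtain ⟨t, ht, htK⟩ := hx
    obtain ⟨V, hVt, hV, hxV⟩ := mem_nhds_iff.1 ht
    refine mem_of_superset (hV.mem_nhds hxV) ?_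
    have hcl : IsClosed (((↑) : X → UniformSpace.Completion X) '' K) :=
      (hK.image hemb.continuous).isClosed
    refine (hι.dense.open_subset_closure_inter hV).trans
      ((closure_minimal ?_ hcl).trans (image_subset_range _ _))
    rintro _ ⟨hz, z, rfl⟩
    exact ⟨z, htK (hVt hz), rfl⟩
  have : PolishSpace (range ((↑) : X → UniformSpace.Completion X)) := hopen.polishSpace
  exact hemb.toHomeomorph.isClosedEmbedding.IsCompletelyMetrizableSpace

/-! ### Closed maps with compact fibres -/

section ClosedMap

open Set Filter Topology

variable {X Y : Type*} [TopologicalSpace X] [TopologicalSpace Y] {π : X → Y}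

theorem IsClosedMap.t2Space_of_isCompact_fiber [T2Space X] (hcl : IsClosedMap π)
    (hsurj : Function.Surjective π) (hfib : ∀ y, IsCompact (π ⁻¹' {y})) : T2Space Y := by
  refine ⟨fun y y' hne => ?_⟩
  obtain ⟨U, V, hU, hV, hyU, hyV, hUV⟩ := SeparatedNhds.of_isCompact_isCompact (hfib y) (hfib y')
    (disjoint_left.2 fun x hx hx' => hne (hx.symm.trans hx'))
  refine ⟨kernImage π U, kernImage π V, isClosedMap_iff_kernImage.1 hcl hU,
    isClosedMap_iff_kernImage.1 hcl hV, fun x hx => hyU hx, fun x hx => hyV hx,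
    disjoint_left.2 fun z hz hz' => ?_⟩
  obtain ⟨x, rfl⟩ := hsurj z
  exact disjoint_left.1 hUV (hz rfl) (hz' rfl)

/-- A basis of the target is given by the sets of points whose fibre lies in a finite union of
members of a basis of the source. -/
theorem IsClosedMap.secondCountableTopology_of_isCompact_fiber [SecondCountableTopology X]
    (hcl : IsClosedMap π) (hcont : Continuous π)
    (hsurj : Function.Surjective π) (hfib : ∀ y, IsCompact (π ⁻¹' {y})) :
    SecondCountableTopology Y := by
  have hB := TopologicalSpace.isBasis_countableBasis X
  let C : Set (Set Y) := (fun F : Set (Set X) => kernImage π (⋃₀ F)) ''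
    {F | F.Finite ∧ F ⊆ TopologicalSpace.countableBasis X}
  have hC : C.Countable :=
    (countable_ofPred_finite_subset (TopologicalSpace.countable_countableBasis X)).image _
  refine TopologicalSpace.IsTopologicalBasis.secondCountableTopology
    (b := C) (TopologicalSpace.isTopologicalBasis_of_isOpen_of_nhds ?_ ?_) hC
  · rintro _ ⟨F, ⟨-, hF⟩, rfl⟩
    exact isClosedMap_iff_kernImage.1 hcl (isOpen_sUnion fun U hU => hB.isOpen (hF hU))
  · intro y U hy hU
    have hpU : IsOpen (π ⁻¹' U) := hU.preimage hcont
    choose! B hB1 hB2 hB3 using fun x (hx : x ∈ π ⁻¹' U) => hB.exists_subset_of_mem_open hx hpU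
    have hsub : π ⁻¹' {y} ⊆ π ⁻¹' U := fun x hx => by
      have : π x = y := hx
      simpa [this] using hy
    obtain ⟨t, ht, hcov⟩ := (hfib y).elim_nhds_subcover B
      fun x hx => (hB.isOpen (hB1 x (hsub hx))).mem_nhds (hB2 x (hsub hx))
    refine ⟨_, ⟨B '' t, ⟨t.finite_toSet.image B, ?_⟩, rfl⟩, ?_, ?_⟩
    · rintro _ ⟨x, hx, rfl⟩
      exact hB1 x (hsub (ht x hx))
    · intro x hx
      rw [sUnion_image]
      exact hcov hx
    · intro z hz
      obtain ⟨x, rfl⟩ := hsurj z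
      obtain ⟨_, ⟨w, hw, rfl⟩, hxw⟩ := hz rfl
      exact hB3 w (hsub (ht w hw)) hxw

theorem IsClosedMap.weaklyLocallyCompactSpace_of_isCompact_fiber [LocallyCompactSpace X]
    (hcl : IsClosedMap π) (hcont : Continuous π)
    (hsurj : Function.Surjective π) (hfib : ∀ y, IsCompact (π ⁻¹' {y})) :
    WeaklyLocallyCompactSpace Y := by
  refine ⟨fun y => ?_⟩
  obtain ⟨K, hK, hyK⟩ := exists_compact_superset (hfib y)
  refine ⟨π '' K, hK.image hcont, mem_of_superset
    ((isClosedMap_iff_kernImage.1 hcl isOpen_interior).mem_nhds fun x hx => hyK hx) ?_⟩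
  intro z hz
  obtain ⟨x, rfl⟩ := hsurj z
  exact ⟨x, interior_subset (hz rfl), rfl⟩

/-- For a closed map with compact fibres, the fibre diameter, measured through a continuous `φ`,
is upper semicontinuous. -/
theorem IsClosedMap.exists_open_dist_lt {N : Type*} [PseudoMetricSpace N] (hcl : IsClosedMap π)
    {φ : X → N} (hφ : Continuous φ) {y : Y} (hfib : IsCompact (π ⁻¹' {y})) {ε : ℝ}
    (h : ∀ x x', π x = y → π x' = y → dist (φ x) (φ x') < ε) :
    ∃ V : Set Y, IsOpen V ∧ y ∈ V ∧
      ∀ x x', π x ∈ V → π x' ∈ V → dist (φ x) (φ x') < ε := by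
  have ho : IsOpen {p : X × X | dist (φ p.1) (φ p.2) < ε} :=
    isOpen_lt (by fun_prop) continuous_const
  obtain ⟨U, V, hU, hV, hyU, hyV, hUV⟩ := generalized_tube_lemma hfib hfib ho
    (fun p hp => h _ _ hp.1 hp.2)
  exact ⟨kernImage π (U ∩ V), isClosedMap_iff_kernImage.1 hcl (hU.inter hV),
    fun x hx => ⟨hyU hx, hyV hx⟩, fun x x' hx hx' =>
      hUV (show (x, x') ∈ U ×ˢ V from ⟨(hx rfl).1, (hx' rfl).2⟩)⟩

end ClosedMap

/-! ### Shrinking of decompositions -/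

section Shrinking

open Set Filter Topology

/-- A nonempty family of continuous surjections, each of which can be approximated uniformly by
members of the family with small fibres over a prescribed compact set, yields a homeomorphism as the
limit of a sequence in the family. -/
theorem exists_homeomorph_of_dense_small_fibers {M Y : Type*} [MetricSpace M] [CompleteSpace M]
    [MetricSpace Y] [CompleteSpace Y] [SigmaCompactSpace Y] [WeaklyLocallyCompactSpace Y]
    (Q : Set (M → Y)) (hne : Q.Nonempty) (hcont : ∀ q ∈ Q, Continuous q)
    (hsurj : ∀ q ∈ Q, Function.Surjective q)
    (hdense : ∀ q ∈ Q, ∀ K : Set Y, IsCompact K → ∀ ε > 0, ∀ δ > 0, ∃ q' ∈ Q,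
      (∀ x, dist (q x) (q' x) < δ) ∧ ∃ r > 0, ∀ y ∈ K, ∀ x x', dist (q' x) y < r →
        dist (q' x') y < r → dist x x' < ε) :
    Nonempty (M ≃ₜ Y) := by
  obtain ⟨q₀, hq₀⟩ := hne
  let K : ℕ → Set Y := CompactExhaustion.choice Y
  have hK : ∀ k, IsCompact (K k) := (CompactExhaustion.choice Y).isCompact
  have hKmono : Monotone K := (CompactExhaustion.choice Y).subset
  -- A state is a map of `Q` with the radius that bounds all further modifications.
  have step : ∀ (k : ℕ) (p : Q × {r : ℝ // 0 < r}), ∃ p' : Q × {r : ℝ // 0 < r},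
      (∀ x, dist ((p.1 : M → Y) x) ((p'.1 : M → Y) x) ≤ (p.2 : ℝ) / 4) ∧
      (p'.2 : ℝ) ≤ p.2 / 2 ∧
      ∀ y ∈ K k, ∀ x x', dist ((p'.1 : M → Y) x) y < p'.2 → dist ((p'.1 : M → Y) x') y < p'.2 →
        dist x x' < (1 / 2 : ℝ) ^ k := by
    rintro k ⟨⟨q, hq⟩, r, hr⟩
    obtain ⟨q', hq', hd, r', hr', hs⟩ := hdense q hq (K k) (hK k) ((1 / 2 : ℝ) ^ k)
      (by positivity) (r / 4) (by positivity)
    refine ⟨⟨⟨q', hq'⟩, min r' (r / 2), lt_min hr' (by positivity)⟩, fun x => (hd x).le,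
      min_le_right _ _, fun y hy x x' hx hx' => hs y hy x x' ?_ ?_⟩
    · exact hx.trans_le (min_le_left _ _)
    · exact hx'.trans_le (min_le_left _ _)
  choose F hF1 hF2 hF3 using step
  let p : ℕ → Q × {r : ℝ // 0 < r} := fun k =>
    Nat.rec ⟨⟨q₀, hq₀⟩, 1, one_pos⟩ (fun k p => F k p) k
  let q : ℕ → M → Y := fun k => (p k).1
  let r : ℕ → ℝ := fun k => (p k).2
  have hqQ : ∀ k, q k ∈ Q := fun k => (p k).1.2
  have hr : ∀ k, 0 < r k := fun k => (p k).2.2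
  have h1 : ∀ k x, dist (q k x) (q (k + 1) x) ≤ r k / 4 := fun k => hF1 k (p k)
  have h2 : ∀ k, r (k + 1) ≤ r k / 2 := fun k => hF2 k (p k)
  have h3 : ∀ k, ∀ y ∈ K k, ∀ x x', dist (q (k + 1) x) y < r (k + 1) →
      dist (q (k + 1) x') y < r (k + 1) → dist x x' < (1 / 2 : ℝ) ^ k := fun k => hF3 k (p k)
  clear_value p
  have htail : ∀ j k x, dist (q k x) (q (k + j) x) ≤ r k / 2 := by
    intro j
    induction j with
    | zero =>
      intro k x
      rw [Nat.add_zero, dist_self]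
      exact (half_pos (hr k)).le
    | succ j ih =>
      intro k x
      have e : k + (j + 1) = k + 1 + j := by omega
      rw [e]
      linarith [dist_triangle (q k x) (q (k + 1) x) (q (k + 1 + j) x), h1 k x, h2 k, ih (k + 1) x]
  have hrpow : ∀ k, r k ≤ r 0 * (1 / 2) ^ k := by
    intro k
    induction k with
    | zero => simp
    | succ k ih => rw [pow_succ]; linarith [h2 k]
  have hr0 : Tendsto r atTop (𝓝 0) := by
    refine squeeze_zero (fun k => (hr k).le) hrpow ?_
    simpa using (tendsto_pow_atTop_nhds_zero_of_lt_one (r := (1 / 2 : ℝ))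
      (by norm_num) (by norm_num)).const_mul (r 0)
  have hcau : ∀ x, CauchySeq fun k => q k x := by
    intro x
    refine cauchySeq_of_le_tendsto_0' r (fun k l hkl => ?_) hr0
    obtain ⟨j, rfl⟩ := Nat.exists_eq_add_of_le hkl
    linarith [htail j k x, hr k]
  choose f hf using fun x => cauchySeq_tendsto_of_complete (hcau x)
  have hfq : ∀ k x, dist (q k x) (f x) ≤ r k / 2 := by
    intro k x
    refine le_of_tendsto (tendsto_const_nhds.dist (hf x)) ?_
    filter_upwards [eventually_ge_atTop k] with l hl
    obtain ⟨j, rfl⟩ := Nat.exists_eq_add_of_le hl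
    exact htail j k x
  have hfcont : Continuous f := by
    have hunif : TendstoUniformly q f atTop := by
      rw [Metric.tendstoUniformly_iff]
      intro ε hε
      filter_upwards [hr0.eventually (gt_mem_nhds hε)] with k hk x
      rw [dist_comm]
      linarith [hfq k x, hr k]
    exact hunif.continuous (Eventually.of_forall fun k => hcont _ (hqQ k)).frequently
  -- Preimages of small balls under the limit are small.
  have hsmall : ∀ y, ∀ ε > 0, ∃ k₀, ∀ k ≥ k₀, ∀ x x', dist (f x) y < r (k + 1) / 2 →
      dist (f x') y < r (k + 1) / 2 → dist x x' < ε := by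
    intro y ε hε
    obtain ⟨k₁, hk₁⟩ := (CompactExhaustion.choice Y).exists_mem y
    obtain ⟨k₂, hk₂⟩ := exists_pow_lt_of_lt_one hε (by norm_num : (1 / 2 : ℝ) < 1)
    refine ⟨max k₁ k₂, fun k hk x x' hx hx' => ?_⟩
    refine (h3 k y (hKmono ((le_max_left _ _).trans hk) hk₁) x x' ?_ ?_).trans_le ?_
    · linarith [dist_triangle (q (k + 1) x) (f x) y, hfq (k + 1) x]
    · linarith [dist_triangle (q (k + 1) x') (f x') y, hfq (k + 1) x']
    · exact (pow_le_pow_of_le_one (by norm_num) (by norm_num)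
        ((le_max_right _ _).trans hk)).trans hk₂.le
  have hinj : Function.Injective f := by
    intro x x' hxx
    refine eq_of_forall_dist_le fun ε hε => ?_
    obtain ⟨k, hk⟩ := hsmall (f x) ε hε
    exact (hk k le_rfl x x' (by simpa using hr _) (by simpa [hxx] using hr _)).le
  have hfsurj : Function.Surjective f := by
    intro y
    choose x hx using fun k => hsurj _ (hqQ k) y
    have hfx : ∀ k, dist (f (x k)) y ≤ r k / 2 := by
      intro k
      have := hfq k (x k)
      rwa [hx, dist_comm] at this
    have hlim : Tendsto (fun k => f (x k)) atTop (𝓝 y) := by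
      rw [tendsto_iff_dist_tendsto_zero]
      refine squeeze_zero (fun _ => dist_nonneg) hfx ?_
      simpa using hr0.div_const 2
    have hxc : CauchySeq x := by
      rw [Metric.cauchySeq_iff]
      intro ε hε
      obtain ⟨k, hk⟩ := hsmall y ε hε
      obtain ⟨N, hN⟩ := eventually_atTop.1
        (hlim.eventually (Metric.ball_mem_nhds y (half_pos (hr (k + 1)))))
      exact ⟨N, fun m hm n hn => hk k le_rfl _ _ (hN m hm) (hN n hn)⟩
    obtain ⟨z, hz⟩ := cauchySeq_tendsto_of_complete hxc
    exact ⟨z, tendsto_nhds_unique ((hfcont.tendsto z).comp hz) hlim⟩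
  refine ⟨{ Equiv.ofBijective f ⟨hinj, hfsurj⟩ with
    continuous_toFun := hfcont
    continuous_invFun := ?_ }⟩
  rw [continuous_iff_continuousAt]
  intro y
  obtain ⟨x, rfl⟩ := hfsurj y
  rw [Metric.continuousAt_iff]
  intro ε hε
  obtain ⟨k, hk⟩ := hsmall (f x) ε hε
  refine ⟨r (k + 1) / 2, half_pos (hr _), fun {z} hz => ?_⟩
  obtain ⟨w, rfl⟩ := hfsurj z
  have e : ∀ u, (Equiv.ofBijective f ⟨hinj, hfsurj⟩).symm (f u) = u :=
    fun u => (Equiv.ofBijective f ⟨hinj, hfsurj⟩).symm_apply_apply u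
  simp only [Equiv.invFun_as_coe, e]
  exact hk k le_rfl w x hz (by simpa using hr _)

/-- The fibres of `π` can be shrunk one at a time: a homeomorphism supported near a given fibre
makes that fibre small, as measured through `φ`, and enlarges no other fibre by more than `ε`. -/
def HasShrinkableFibers {M Y : Type*} [TopologicalSpace M] (N : Type*) [PseudoMetricSpace N]
    (π : M → Y) : Prop :=
  ∀ (y : Y) (W : Set M), IsOpen W → π ⁻¹' {y} ⊆ W → ∀ φ : M → N, Continuous φ → ∀ ε > 0,
    ∃ s : M ≃ₜ M, (∀ x ∉ W, s x = x) ∧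
      (∀ x x', π x = y → π x' = y → dist (φ (s x)) (φ (s x')) ≤ ε) ∧
      ∀ (z : Y) (d : ℝ), (∀ x x', π x = z → π x' = z → dist (φ x) (φ x') ≤ d) →
        ∀ x x', π x = z → π x' = z → dist (φ (s x)) (φ (s x')) ≤ d + ε

/-- If the fibres can be shrunk one at a time and countably many of them are nondegenerate, those
over a compact set can be made small simultaneously. -/
theorem HasShrinkableFibers.exists_homeomorph {M Y N : Type*} [TopologicalSpace M]
    [PseudoMetricSpace Y] [PseudoMetricSpace N] {π : M → Y} (hπ : HasShrinkableFibers N π)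
    (hcont : Continuous π) (hcl : IsClosedMap π) (hfib : ∀ y, IsCompact (π ⁻¹' {y}))
    (hcount : {y | ¬ (π ⁻¹' {y}).Subsingleton}.Countable)
    {φ : M → N} (hφ : Continuous φ) {K : Set Y} (hK : IsCompact K) {ε δ : ℝ}
    (hε : 0 < ε) (hδ : 0 < δ) :
    ∃ s : M ≃ₜ M, (∀ x, dist (π x) (π (s.symm x)) < δ) ∧
      ∀ y ∈ K, ∀ x x', π x = y → π x' = y → dist (φ (s x)) (φ (s x')) < ε := by
  rcases isEmpty_or_nonempty Y with hY | hY
  · exact ⟨Homeomorph.refl M, fun x => isEmptyElim (π x), fun y => isEmptyElim y⟩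
  obtain ⟨g, hg⟩ := countable_iff_exists_subset_range.1 hcount
  have step : ∀ (i : ℕ) (s : M ≃ₜ M), ∃ s' : M ≃ₜ M,
      (∀ x, dist (π (s.symm x)) (π (s'.symm x)) ≤ δ * (1 / 2) ^ (i + 2)) ∧
      (∀ x x', π x = g i → π x' = g i → dist (φ (s' x)) (φ (s' x')) ≤ ε * (1 / 2) ^ (i + 3)) ∧
      ∀ (z : Y) (d : ℝ), (∀ x x', π x = z → π x' = z → dist (φ (s x)) (φ (s x')) ≤ d) →
        ∀ x x', π x = z → π x' = z →
          dist (φ (s' x)) (φ (s' x')) ≤ d + ε * (1 / 2) ^ (i + 3) := by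
    intro i s
    obtain ⟨t, ht1, ht2, ht3⟩ := hπ (g i)
      (π ⁻¹' Metric.ball (g i) (δ * (1 / 2) ^ (i + 2) / 2)) (Metric.isOpen_ball.preimage hcont)
      (fun x hx => by
        have : π x = g i := hx
        simp only [mem_preimage, this]
        exact Metric.mem_ball_self (by positivity))
      (φ ∘ s) (hφ.comp s.continuous) (ε * (1 / 2) ^ (i + 3)) (by positivity)
    refine ⟨t.trans s, fun x => ?_, ht2, ht3⟩
    simp only [Homeomorph.symm_trans_apply]
    generalize s.symm x = w
    by_cases hw : t.symm w ∈ π ⁻¹' Metric.ball (g i) (δ * (1 / 2) ^ (i + 2) / 2)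
    · by_cases hw' : w ∈ π ⁻¹' Metric.ball (g i) (δ * (1 / 2) ^ (i + 2) / 2)
      · have a1 : dist (π (t.symm w)) (g i) < δ * (1 / 2) ^ (i + 2) / 2 := hw
        have a2 : dist (π w) (g i) < δ * (1 / 2) ^ (i + 2) / 2 := hw'
        linarith [dist_triangle_right (π w) (π (t.symm w)) (g i)]
      · have : t.symm w = w := by rw [t.symm_apply_eq, ht1 w hw']
        rw [this, dist_self]; positivity
    · have : w = t.symm w := by simpa using ht1 _ hw
      rw [← this, dist_self]; positivity
  choose F hF1 hF2 hF3 using step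
  let s : ℕ → M ≃ₜ M := fun i => Nat.rec (Homeomorph.refl M) (fun i s => F i s) i
  have hs0 : s 0 = Homeomorph.refl M := rfl
  have h1 : ∀ i x, dist (π ((s i).symm x)) (π ((s (i + 1)).symm x)) ≤ δ * (1 / 2) ^ (i + 2) :=
    fun i => hF1 i (s i)
  have h2 : ∀ i x x', π x = g i → π x' = g i →
      dist (φ (s (i + 1) x)) (φ (s (i + 1) x')) ≤ ε * (1 / 2) ^ (i + 3) := fun i => hF2 i (s i)
  have h3 : ∀ i (z : Y) (d : ℝ),
      (∀ x x', π x = z → π x' = z → dist (φ (s i x)) (φ (s i x')) ≤ d) →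
        ∀ x x', π x = z → π x' = z →
          dist (φ (s (i + 1) x)) (φ (s (i + 1) x')) ≤ d + ε * (1 / 2) ^ (i + 3) :=
    fun i => hF3 i (s i)
  clear_value s
  have hdist : ∀ i x, dist (π x) (π ((s i).symm x)) ≤ δ * (1 / 2 - (1 / 2) ^ (i + 1)) := by
    intro i x
    induction i with
    | zero => simp [hs0]
    | succ i ih =>
      have := dist_triangle (π x) (π ((s i).symm x)) (π ((s (i + 1)).symm x))
      have := h1 i x
      simp only [pow_succ] at *
      linarith
  -- The bound on fibres increases with `i` by enough to absorb the growth in each step.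
  let e : ℕ → ℝ := fun i => ε * (1 - (1 / 2) ^ (i + 1))
  have he : ∀ i, e i + ε * (1 / 2) ^ (i + 3) < e (i + 1) := by
    intro i
    have : 0 < ε * (1 / 2) ^ i := by positivity
    simp only [e, pow_succ]
    linarith
  have he0 : ∀ i, 0 < e i := fun i =>
    mul_pos hε (sub_pos.2 (pow_lt_one₀ (by norm_num) (by norm_num) (by omega)))
  let U : ℕ → Set Y := fun i =>
    {y | ∀ x x', π x = y → π x' = y → dist (φ (s i x)) (φ (s i x')) < e i}
  have hUopen : ∀ i, IsOpen (U i) := by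
    intro i
    rw [isOpen_iff_mem_nhds]
    intro y hy
    obtain ⟨V, hV, hyV, h⟩ := hcl.exists_open_dist_lt (hφ.comp (s i).continuous) (hfib y) hy
    refine mem_of_superset (hV.mem_nhds hyV) ?_
    rintro z hz x x' rfl hx'
    exact h x x' hz (by rwa [hx'])
  have hUmono : Monotone U := by
    refine monotone_nat_of_le_succ fun i y hy x x' hx hx' => ?_
    exact (h3 i y (e i) (fun w w' hw hw' => (hy w w' hw hw').le) x x' hx hx').trans_lt (he i)
  have hcov : K ⊆ ⋃ i, U i := by
    intro y _
    rw [mem_iUnion]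
    by_cases hy : (π ⁻¹' {y}).Subsingleton
    · refine ⟨0, fun x x' hx hx' => ?_⟩
      rw [hy hx hx', dist_self]
      exact he0 0
    · obtain ⟨i, rfl⟩ := hg hy
      exact ⟨i + 1, fun x x' hx hx' => (h2 i x x' hx hx').trans_lt
        ((lt_add_of_pos_left _ (he0 i)).trans (he i))⟩
  obtain ⟨i, hi⟩ := hK.elim_directed_cover U hUopen hcov hUmono.directed_le
  refine ⟨s i, fun x => (hdist i x).trans_lt ?_, fun y hy x x' hx hx' => ?_⟩
  · have : 0 < δ * (1 / 2 : ℝ) ^ (i + 1) := by positivity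
    linarith
  · refine (hi hy x x' hx hx').trans ?_
    have : 0 < ε * (1 / 2 : ℝ) ^ (i + 1) := by positivity
    simp only [e]
    linarith

theorem HasShrinkableFibers.nonempty_homeomorph {M Y : Type*} [MetricSpace M] [CompleteSpace M]
    [MetricSpace Y] [CompleteSpace Y] [SigmaCompactSpace Y] [WeaklyLocallyCompactSpace Y]
    {π : M → Y} (hπ : HasShrinkableFibers M π)
    (hcont : Continuous π) (hcl : IsClosedMap π) (hsurj : Function.Surjective π)
    (hfib : ∀ y, IsCompact (π ⁻¹' {y}))
    (hcount : {y | ¬ (π ⁻¹' {y}).Subsingleton}.Countable) : Nonempty (M ≃ₜ Y) := by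
  refine exists_homeomorph_of_dense_small_fibers {q | ∃ h : M ≃ₜ M, q = π ∘ h.symm}
    ⟨_, Homeomorph.refl M, rfl⟩ ?_ ?_ ?_
  · rintro _ ⟨h, rfl⟩
    exact hcont.comp h.symm.continuous
  · rintro _ ⟨h, rfl⟩
    exact hsurj.comp h.symm.surjective
  · rintro _ ⟨h, rfl⟩ K hK ε hε δ hδ
    obtain ⟨s, hs1, hs2⟩ := hπ.exists_homeomorph hcont hcl hfib hcount h.continuous hK hε hδ
    refine ⟨_, ⟨s.trans h, rfl⟩, fun x => hs1 (h.symm x), ?_⟩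
    -- Smallness of the fibres over `K` extends, uniformly, to preimages of small balls.
    choose! V hV hyV hVd using fun y (hy : y ∈ K) =>
      hcl.exists_open_dist_lt (h.continuous.comp s.continuous) (hfib y) (hs2 y hy)
    obtain ⟨r, hr, hleb⟩ := lebesgue_number_lemma_of_metric (c := fun y : K => V y) hK
      (fun y => hV y y.2) fun y hy => mem_iUnion.2 ⟨⟨y, hy⟩, hyV y hy⟩
    refine ⟨r, hr, fun y hy x x' hx hx' => ?_⟩
    obtain ⟨z, hz⟩ := hleb y hy
    simpa using hVd z z.2 ((s.trans h).symm x) ((s.trans h).symm x') (hz hx) (hz hx')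

end Shrinking

/-! ### Slowly varying functions of the distance -/

section Layers

open Set Filter Topology

/-- A function rising from `0` to `m` in `m` unit steps, whose oscillation on each fibre of `κ` is
at most one step. Each new step is placed so close to `0` that the fibres meeting it stay in the
region where the previous function vanishes. -/
theorem exists_step_function {E Y : Type*} {κ : E → Y} {ρ : E → ℝ}
    (H : ∀ r > 0, ∃ r' > 0, r' ≤ r ∧ ∀ x x', κ x = κ x' → ρ x ≤ r' → ρ x' < r)
    {r : ℝ} (hr : 0 < r) (m : ℕ) :
    ∃ σ : ℝ → ℝ, Continuous σ ∧ Monotone σ ∧ (∃ r' > 0, r' ≤ r ∧ ∀ t ≤ r', σ t = 0) ∧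
      (∀ t ≥ r, σ t = m) ∧ ∀ x x', κ x = κ x' → |σ (ρ x) - σ (ρ x')| ≤ 1 := by
  induction m with
  | zero => exact ⟨fun _ => 0, continuous_const, monotone_const, ⟨r, hr, le_rfl, fun _ _ => rfl⟩,
      fun _ _ => by simp, fun _ _ _ => by simp⟩
  | succ m ih =>
    obtain ⟨σ, hc, hm, ⟨r₁, hr₁, hr₁r, h0⟩, h1, hosc⟩ := ih
    obtain ⟨r₂, hr₂, hr₂₁, hsep⟩ := H r₁ hr₁
    let c : ℝ → ℝ := fun t => max 0 (min 1 (2 * t / r₂ - 1))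
    have hc0 : ∀ t ≤ r₂ / 2, c t = 0 := by
      intro t ht
      have : 2 * t / r₂ ≤ 1 := by rw [div_le_one hr₂]; linarith
      exact max_eq_left ((min_le_right _ _).trans (by linarith))
    have hc1 : ∀ t ≥ r₂, c t = 1 := by
      intro t ht
      have : 2 ≤ 2 * t / r₂ := by rw [le_div_iff₀ hr₂]; linarith
      simp only [c]
      rw [min_eq_left (by linarith), max_eq_right zero_le_one]
    have hcn : ∀ t, 0 ≤ c t := fun t => le_max_left _ _
    have hcl : ∀ t, c t ≤ 1 := fun t => max_le zero_le_one (min_le_left _ _)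
    refine ⟨fun t => σ t + c t, by fun_prop, hm.add ?_, ⟨r₂ / 2, half_pos hr₂, by linarith, ?_⟩,
      ?_, ?_⟩
    · intro t t' ht
      exact max_le_max le_rfl (min_le_min le_rfl (by gcongr))
    · intro t ht
      simp only
      rw [h0 t (by linarith), hc0 t ht, add_zero]
    · intro t ht
      simp only
      rw [h1 t ht, hc1 t (by linarith)]
      push_cast
      ring
    · intro x x' hx
      -- A fibre meeting the new layer is contained in the region where `σ` vanishes.
      have key : ∀ x x', κ x = κ x' → ρ x ≤ r₂ →
          |σ (ρ x) + c (ρ x) - (σ (ρ x') + c (ρ x'))| ≤ 1 := by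
        intro x x' hx hρ
        rw [h0 _ (hsep x x rfl hρ).le, h0 _ (hsep x x' hx hρ).le, abs_le]
        constructor <;> linarith [hcn (ρ x), hcl (ρ x), hcn (ρ x'), hcl (ρ x')]
      rcases le_total (ρ x) r₂ with h | h
      · exact key x x' hx h
      rcases le_total (ρ x') r₂ with h' | h'
      · rw [abs_sub_comm]
        exact key x' x hx.symm h'
      · simp only
        rw [hc1 _ h, hc1 _ h', add_sub_add_right_eq_sub]
        exact hosc x x' hx

/-- If sublevel sets of `ρ` can be separated by unions of fibres of `κ`, there is a function of `ρ`
increasing from `0` to `1` arbitrarily close to the set `ρ ≤ 0` whose oscillation on each fibre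
is small: it rises in many small steps, and each fibre meets at most one of them. -/
theorem exists_slow_transition {E Y : Type*} {κ : E → Y} {ρ : E → ℝ}
    (H : ∀ r > 0, ∃ r' > 0, r' ≤ r ∧ ∀ x x', κ x = κ x' → ρ x ≤ r' → ρ x' < r)
    {r τ : ℝ} (hr : 0 < r) (hτ : 0 < τ) :
    ∃ σ : ℝ → ℝ, Continuous σ ∧ Monotone σ ∧ (∀ t ≤ 0, σ t = 0) ∧
      (∀ t ≥ r, σ t = 1) ∧ ∀ x x', κ x = κ x' → |σ (ρ x) - σ (ρ x')| ≤ τ := by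
  obtain ⟨m, hm⟩ := exists_nat_one_div_lt hτ
  obtain ⟨σ, hc, hmono, ⟨r', hr', -, h0⟩, h1, hosc⟩ := exists_step_function H hr (m + 1)
  have hm0 : (0 : ℝ) < m + 1 := by positivity
  refine ⟨fun t => σ t / (m + 1), by fun_prop, fun t t' ht => ?_, fun t ht => ?_, fun t ht => ?_,
    fun x x' hx => ?_⟩
  · exact div_le_div_of_nonneg_right (hmono ht) hm0.le
  · simp [h0 t (by linarith)]
  · simp only [h1 t ht]
    push_cast
    exact div_self hm0.ne'
  · simp only
    rw [← sub_div, abs_div, abs_of_pos hm0]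
    exact (div_le_div_of_nonneg_right (hosc x x' hx) hm0.le).trans hm.le

end Layers

/-! ### Compression of a segment in a vector space -/

section Compression

open Set Filter Topology

variable {E : Type*} [NormedAddCommGroup E] [NormedSpace ℝ E]

/-- The component of `x - a` in the kernel of `L`, along the direction `v`, where `L v = 1`. -/
def transverse (L : E →L[ℝ] ℝ) (a v x : E) : E := x - a - L (x - a) • v

/-- A gauge of the distance from `x` to the segment from `a` to `a + v`, where `L v = 1`; the
segment is the set on which it is at most `0`. -/
def segmentGauge (L : E →L[ℝ] ℝ) (a v x : E) : ℝ :=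
  max ‖transverse L a v x‖ (max (-L (x - a)) (L (x - a) - 1))

/-- The longitudinal coordinate of the image of `x` under `compress`: the coordinate of `x` cut
off at a level that grows with the gauge of `x`. The terms with `η` make it strictly increasing
in the direction `v`. -/
def compressedCoord (L : E →L[ℝ] ℝ) (a v : E) (σ : ℝ → ℝ) (η : ℝ) (x : E) : ℝ :=
  min (L (x - a)) (segmentGauge L a v x + η + σ (segmentGauge L a v x) + η * L (x - a))

/-- The map which compresses the segment from `a` to `a + v` towards `a` by moving points parallel
to `v`. -/
def compress (L : E →L[ℝ] ℝ) (a v : E) (σ : ℝ → ℝ) (η : ℝ) (x : E) : E :=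
  x + (compressedCoord L a v σ η x - L (x - a)) • v

variable {L : E →L[ℝ] ℝ} {a v : E}

theorem segmentGauge_nonneg (x : E) : 0 ≤ segmentGauge L a v x :=
  (norm_nonneg _).trans (le_max_left _ _)

theorem norm_transverse_le (x : E) : ‖transverse L a v x‖ ≤ segmentGauge L a v x :=
  le_max_left _ _

theorem neg_coord_le (x : E) : -L (x - a) ≤ segmentGauge L a v x :=
  (le_max_left _ _).trans (le_max_right _ _)

theorem coord_sub_one_le (x : E) : L (x - a) - 1 ≤ segmentGauge L a v x :=
  (le_max_right _ _).trans (le_max_right _ _)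

@[fun_prop]
theorem continuous_segmentGauge : Continuous (segmentGauge L a v) := by
  unfold segmentGauge transverse
  fun_prop

theorem continuous_compress {σ : ℝ → ℝ} (hσ : Continuous σ) {η : ℝ} :
    Continuous (compress L a v σ η) := by
  unfold compress compressedCoord
  fun_prop

theorem coord_add_smul (hL : L v = 1) (x : E) (c : ℝ) :
    L (x + c • v - a) = L (x - a) + c := by
  simp [hL]; ring

theorem transverse_add_smul (hL : L v = 1) (x : E) (c : ℝ) :
    transverse L a v (x + c • v) = transverse L a v x := by
  simp only [transverse, coord_add_smul hL, add_smul]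
  abel

theorem segmentGauge_le_zero_iff (hL : L v = 1) (x : E) :
    segmentGauge L a v x ≤ 0 ↔ x ∈ segment ℝ a (a + v) := by
  rw [segment_eq_image', mem_image]
  constructor
  · intro h
    have h1 : transverse L a v x = 0 := norm_le_zero_iff.1 ((norm_transverse_le x).trans h)
    have h2 := (neg_coord_le (L := L) (a := a) (v := v) x).trans h
    have h3 := (coord_sub_one_le (L := L) (a := a) (v := v) x).trans h
    refine ⟨L (x - a), ⟨by linarith, by linarith⟩, ?_⟩
    simp only [transverse, sub_eq_zero] at h1
    rw [add_sub_cancel_left, ← h1]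
    abel
  · rintro ⟨θ, ⟨h0, h1⟩, rfl⟩
    simp [segmentGauge, transverse, hL, h0, h1]

theorem dist_le_of_transverse (x x' : E) : dist x x' ≤
    ‖transverse L a v x‖ + ‖transverse L a v x'‖ + |L (x - a) - L (x' - a)| * ‖v‖ := by
  have e : x - x' = transverse L a v x - transverse L a v x' +
      (L (x - a) - L (x' - a)) • v := by
    simp only [transverse, sub_smul]
    abel
  rw [dist_eq_norm, e, ← Real.norm_eq_abs, ← norm_smul]
  exact (norm_add_le _ _).trans (add_le_add_left (norm_sub_le _ _) _)

theorem isCompact_segmentGauge_le [FiniteDimensional ℝ E] (r : ℝ) :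
    IsCompact {x | segmentGauge L a v x ≤ r} := by
  have : ProperSpace E := FiniteDimensional.proper ℝ E
  refine (isCompact_closedBall a (r + (r + 1) * ‖v‖)).of_isClosed_subset
    (isClosed_le continuous_segmentGauge continuous_const) fun x hx => ?_
  have hx' : segmentGauge L a v x ≤ r := hx
  have h := dist_le_of_transverse (L := L) (a := a) (v := v) x a
  have h1 : |L (x - a)| ≤ r + 1 := abs_le.2
    ⟨by linarith [neg_coord_le (L := L) (a := a) (v := v) x],
     by linarith [coord_sub_one_le (L := L) (a := a) (v := v) x]⟩
  have h2 : transverse L a v a = 0 := by simp [transverse]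
  rw [h2, norm_zero, add_zero, sub_self, map_zero, sub_zero] at h
  exact h.trans (add_le_add ((norm_transverse_le x).trans hx')
    (mul_le_mul_of_nonneg_right h1 (norm_nonneg v)))

/-- The sublevel sets of the gauge form a neighbourhood basis of the segment. -/
theorem exists_segmentGauge_le_subset [FiniteDimensional ℝ E] (hL : L v = 1) {Z : Set E}
    (hZ : IsOpen Z) (h : segment ℝ a (a + v) ⊆ Z) :
    ∃ r > 0, ∀ x, segmentGauge L a v x ≤ r → x ∈ Z := by
  have hK : IsCompact ({x | segmentGauge L a v x ≤ 1} \ Z) :=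
    (isCompact_segmentGauge_le 1).diff hZ
  rcases ({x | segmentGauge L a v x ≤ 1} \ Z).eq_empty_or_nonempty with he | hne
  · exact ⟨1, one_pos, fun x hx => sdiff_eq_empty.1 he hx⟩
  · obtain ⟨z, hz, hmin⟩ := hK.exists_isMinOn hne
      (continuous_segmentGauge (L := L) (a := a) (v := v)).continuousOn
    have hz0 : 0 < segmentGauge L a v z :=
      not_le.1 fun h0 => hz.2 (h ((segmentGauge_le_zero_iff hL z).1 h0))
    refine ⟨segmentGauge L a v z / 2, half_pos hz0, fun x hx => ?_⟩
    by_contra hxZ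
    have hz1 : segmentGauge L a v z ≤ 1 := hz.1
    have hx1 : segmentGauge L a v x ≤ 1 := by linarith
    have : segmentGauge L a v z ≤ segmentGauge L a v x := hmin ⟨hx1, hxZ⟩
    linarith

section

variable {σ : ℝ → ℝ} {η : ℝ}

theorem coord_compress (hL : L v = 1) (x : E) :
    L (compress L a v σ η x - a) = compressedCoord L a v σ η x := by
  rw [compress, coord_add_smul hL]; ring

theorem transverse_compress (hL : L v = 1) (x : E) :
    transverse L a v (compress L a v σ η x) = transverse L a v x :=
  transverse_add_smul hL _ _

theorem compressedCoord_eq_of_nonpos (hσ : ∀ t, 0 ≤ σ t) (hη : 0 < η) (hη1 : η ≤ 1) {x : E}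
    (hx : L (x - a) ≤ 0) : compressedCoord L a v σ η x = L (x - a) := by
  refine min_eq_left ?_
  have := segmentGauge_nonneg (L := L) (a := a) (v := v) x
  have := hσ (segmentGauge L a v x)
  nlinarith

theorem compressedCoord_pos (hσ : ∀ t, 0 ≤ σ t) (hη : 0 < η) {x : E}
    (hx : 0 < L (x - a)) : 0 < compressedCoord L a v σ η x := by
  refine lt_min hx ?_
  have := segmentGauge_nonneg (L := L) (a := a) (v := v) x
  have := hσ (segmentGauge L a v x)
  positivity

theorem compressedCoord_le (x : E) : compressedCoord L a v σ η x ≤ L (x - a) := min_le_left _ _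

theorem compressedCoord_eq_of_one (hσ : ∀ t, 0 ≤ σ t) (hη : 0 < η) (hη1 : η ≤ 1) {x : E}
    (hx : σ (segmentGauge L a v x) = 1) : compressedCoord L a v σ η x = L (x - a) := by
  rcases le_total (L (x - a)) 0 with h | h
  · exact compressedCoord_eq_of_nonpos hσ hη hη1 h
  · refine min_eq_left ?_
    have := coord_sub_one_le (L := L) (a := a) (v := v) x
    have : 0 ≤ η * L (x - a) := by positivity
    rw [hx]
    linarith

theorem segmentGauge_compress_le (hL : L v = 1) (hσ : ∀ t, 0 ≤ σ t) (hη : 0 < η) (hη1 : η ≤ 1)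
    (x : E) : segmentGauge L a v (compress L a v σ η x) ≤ segmentGauge L a v x := by
  rw [segmentGauge, transverse_compress hL, coord_compress hL]
  refine max_le (norm_transverse_le x) (max_le ?_ ?_)
  · rcases le_or_gt (L (x - a)) 0 with h | h
    · rw [compressedCoord_eq_of_nonpos hσ hη hη1 h]
      exact neg_coord_le x
    · linarith [compressedCoord_pos (v := v) hσ hη h,
        segmentGauge_nonneg (L := L) (a := a) (v := v) x]
  · linarith [compressedCoord_le (L := L) (a := a) (v := v) (σ := σ) (η := η) x,
      coord_sub_one_le (L := L) (a := a) (v := v) x]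

theorem strictMono_compressedCoord (hL : L v = 1) (hσ : ∀ t, 0 ≤ σ t) (hmono : Monotone σ)
    (hη : 0 < η) (hη1 : η ≤ 1) (x : E) :
    StrictMono fun c : ℝ => compressedCoord L a v σ η (x + c • v) := by
  intro c c' hc
  have e := coord_add_smul (a := a) hL x c
  have e' := coord_add_smul (a := a) hL x c'
  simp only
  rcases le_or_gt (L (x + c' • v - a)) 0 with h' | h'
  · rw [compressedCoord_eq_of_nonpos hσ hη hη1 h',
      compressedCoord_eq_of_nonpos hσ hη hη1 (by linarith)]
    linarith
  rcases le_or_gt (L (x + c • v - a)) 0 with h | h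
  · rw [compressedCoord_eq_of_nonpos hσ hη hη1 h]
    exact h.trans_lt (compressedCoord_pos hσ hη h')
  -- On the half-space of positive coordinate the gauge is nondecreasing in the direction `v`.
  have hg : segmentGauge L a v (x + c • v) ≤ segmentGauge L a v (x + c' • v) := by
    refine max_le ?_ (max_le ?_ ?_)
    · rw [transverse_add_smul hL, ← transverse_add_smul hL x c']
      exact norm_transverse_le _
    · linarith [segmentGauge_nonneg (L := L) (a := a) (v := v) (x + c' • v)]
    · linarith [coord_sub_one_le (L := L) (a := a) (v := v) (x + c' • v)]
  have hs := hmono hg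
  have hm : η * L (x + c • v - a) < η * L (x + c' • v - a) :=
    mul_lt_mul_of_pos_left (by linarith) hη
  exact min_lt_min (by linarith) (by linarith)

theorem bijective_compress (hL : L v = 1) (hcont : Continuous σ) (hσ : ∀ t, 0 ≤ σ t)
    (hmono : Monotone σ) (hσ1 : ∀ t ≥ 1, σ t = 1) (hη : 0 < η) (hη1 : η ≤ 1) :
    Function.Bijective (compress L a v σ η) := by
  constructor
  · intro x x' h
    have h1 : compressedCoord L a v σ η x = compressedCoord L a v σ η x' := by
      rw [← coord_compress hL, h, coord_compress hL]
    have h2 : transverse L a v x = transverse L a v x' := by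
      rw [← transverse_compress (σ := σ) (η := η) hL, h, transverse_compress hL]
    have h3 : x' = x + (L (x' - a) - L (x - a)) • v := by
      simp only [transverse] at h2
      rw [sub_smul, ← sub_eq_zero]
      rw [← sub_eq_zero] at h2
      rw [← neg_eq_zero, ← h2]
      abel
    have h4 := (strictMono_compressedCoord (a := a) hL hσ hmono hη hη1 x).injective
      (a₁ := 0) (a₂ := L (x' - a) - L (x - a)) (by simp only [zero_smul, add_zero, ← h3, h1])
    rw [← h4, zero_smul, add_zero] at h3
    exact h3.symm
  · intro y
    have hc : Continuous fun c : ℝ => compressedCoord L a v σ η (y + c • v) := by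
      unfold compressedCoord
      fun_prop
    obtain ⟨c, hc⟩ := mem_range_of_exists_le_of_exists_ge hc (c := L (y - a))
      ⟨min 0 (-L (y - a)), by
        refine (compressedCoord_le _).trans ?_
        rw [coord_add_smul hL]
        linarith [min_le_left 0 (-L (y - a))]⟩
      ⟨max 0 (2 - L (y - a)), by
        have h := coord_add_smul (a := a) hL y (max 0 (2 - L (y - a)))
        rw [compressedCoord_eq_of_one hσ hη hη1 (hσ1 _ ?_), h]
        · linarith [le_max_left 0 (2 - L (y - a))]
        · refine le_trans ?_ (coord_sub_one_le _)
          rw [h]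
          linarith [le_max_right 0 (2 - L (y - a))]⟩
    refine ⟨y + c • v, ?_⟩
    simp only at hc
    rw [compress, hc, coord_add_smul hL, add_assoc, ← add_smul]
    simp

/-- The compression moves the points of a connected set `T` close to the segment, on which the
cut-off level varies little, either close to points of `T` or close to each other: a point above
the cut-off level `k` is moved close to a point of `T` at that level, if `T` crosses it. -/
theorem dist_compress_le {N : Type*} [PseudoMetricSpace N] {κ : E → N} (hL : L v = 1)
    (hσ : ∀ t, 0 ≤ σ t) (hη : 0 < η) (hη1 : η ≤ 1) {τ lam ε d : ℝ} (hτ1 : τ ≤ 1)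
    (hητ : η ≤ τ) (hlam : τ * (2 + 10 * ‖v‖) < lam)
    (hunif : ∀ x x', segmentGauge L a v x ≤ 1 → segmentGauge L a v x' ≤ 1 → dist x x' < lam →
      dist (κ x) (κ x') < ε / 2)
    {T : Set E} (hT : IsPreconnected T) (hTτ : ∀ x ∈ T, segmentGauge L a v x ≤ τ) {k : ℝ}
    (hk : ∀ x ∈ T, |σ (segmentGauge L a v x) - k| ≤ τ)
    (hd : ∀ x ∈ T, ∀ x' ∈ T, dist (κ x) (κ x') ≤ d) {x x' : E} (hx : x ∈ T) (hx' : x' ∈ T) :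
    dist (κ (compress L a v σ η x)) (κ (compress L a v σ η x')) ≤ d + ε := by
  have hF : ∀ x ∈ T, |compressedCoord L a v σ η x - min (L (x - a)) k| ≤ 5 * τ := by
    intro x hx
    have h1 := hTτ x hx
    have h2 := segmentGauge_nonneg (L := L) (a := a) (v := v) x
    have h3 := abs_le.1 (hk x hx)
    have h4 := neg_coord_le (L := L) (a := a) (v := v) x
    have h5 := coord_sub_one_le (L := L) (a := a) (v := v) x
    have h6 : |η * L (x - a)| ≤ η * 2 := by
      rw [abs_mul, abs_of_pos hη]
      exact mul_le_mul_of_nonneg_left (abs_le.2 ⟨by linarith, by linarith⟩) hη.le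
    have h7 := abs_le.1 h6
    refine (abs_min_sub_min_le_max _ _ _ _).trans (max_le ?_ (abs_le.2 ⟨?_, ?_⟩))
    · rw [sub_self, abs_zero]
      linarith
    · linarith
    · linarith
  have hD : ∀ x ∈ T, segmentGauge L a v (compress L a v σ η x) ≤ 1 := fun x hx =>
    (segmentGauge_compress_le hL hσ hη hη1 x).trans ((hTτ x hx).trans hτ1)
  have hP : ∀ x ∈ T, ‖transverse L a v x‖ ≤ τ := fun x hx =>
    (norm_transverse_le x).trans (hTτ x hx)
  have hv := norm_nonneg v
  by_cases hlow : ∃ z ∈ T, L (z - a) ≤ k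
  · obtain ⟨z, hz, hzk⟩ := hlow
    have hnear : ∀ x ∈ T, ∃ u ∈ T, dist (κ (compress L a v σ η x)) (κ u) < ε / 2 := by
      intro x hx
      obtain ⟨u, hu, hux⟩ : ∃ u ∈ T, L (u - a) = min (L (x - a)) k := by
        rcases le_total (L (x - a)) k with h | h
        · exact ⟨x, hx, (min_eq_left h).symm⟩
        · rw [min_eq_right h]
          exact hT.intermediate_value hz hx (f := fun y => L (y - a)) (by fun_prop) ⟨hzk, h⟩
      refine ⟨u, hu, hunif _ _ (hD x hx) ((hTτ u hu).trans hτ1) ?_⟩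
      refine (dist_le_of_transverse (L := L) (a := a) (v := v) _ _).trans_lt ?_
      rw [transverse_compress hL, coord_compress hL, hux]
      have := mul_le_mul_of_nonneg_right (hF x hx) hv
      nlinarith [hP x hx, hP u hu, segmentGauge_nonneg (L := L) (a := a) (v := v) x, hTτ x hx]
    obtain ⟨u, hu, hxu⟩ := hnear x hx
    obtain ⟨u', hu', hxu'⟩ := hnear x' hx'
    have := hd u hu u' hu'
    rw [dist_comm] at hxu'
    linarith [dist_triangle4 (κ (compress L a v σ η x)) (κ u) (κ u')
      (κ (compress L a v σ η x'))]
  · push Not at hlow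
    have hd0 : 0 ≤ d := dist_nonneg.trans (hd x hx x hx)
    have h1 := hF x hx
    have h2 := hF x' hx'
    rw [min_eq_right (hlow x hx).le] at h1
    rw [min_eq_right (hlow x' hx').le, abs_sub_comm] at h2
    have h3 := abs_sub_le (compressedCoord L a v σ η x) k (compressedCoord L a v σ η x')
    have h4 : dist (κ (compress L a v σ η x)) (κ (compress L a v σ η x')) < ε / 2 := by
      refine hunif _ _ (hD x hx) (hD x' hx') ?_
      refine (dist_le_of_transverse (L := L) (a := a) (v := v) _ _).trans_lt ?_
      rw [transverse_compress hL, coord_compress hL, transverse_compress hL, coord_compress hL]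
      have := mul_le_mul_of_nonneg_right (h3.trans (add_le_add h1 h2)) hv
      linarith [hP x hx, hP x' hx']
    linarith [dist_nonneg.trans_lt h4]

/-- The segment itself is compressed to a short one. -/
theorem dist_compress_segment_lt {N : Type*} [PseudoMetricSpace N] {κ : E → N} (hL : L v = 1)
    (hσ : ∀ t, 0 ≤ σ t) (hσ0 : ∀ t ≤ 0, σ t = 0) (hη : 0 < η) (hη1 : η ≤ 1) {lam ε : ℝ}
    (hlam : η * (2 + 10 * ‖v‖) < lam)
    (hunif : ∀ x x', segmentGauge L a v x ≤ 1 → segmentGauge L a v x' ≤ 1 → dist x x' < lam →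
      dist (κ x) (κ x') < ε / 2) {x x' : E} (hx : segmentGauge L a v x ≤ 0)
    (hx' : segmentGauge L a v x' ≤ 0) :
    dist (κ (compress L a v σ η x)) (κ (compress L a v σ η x')) < ε / 2 := by
  have hF : ∀ x, segmentGauge L a v x ≤ 0 → 0 ≤ compressedCoord L a v σ η x ∧
      compressedCoord L a v σ η x ≤ 2 * η := by
    intro x hx
    have h4 := neg_coord_le (L := L) (a := a) (v := v) x
    have h5 := coord_sub_one_le (L := L) (a := a) (v := v) x
    constructor
    · rcases le_or_gt (L (x - a)) 0 with h | h
      · rw [compressedCoord_eq_of_nonpos hσ hη hη1 h]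
        linarith
      · exact (compressedCoord_pos hσ hη h).le
    · refine (min_le_right _ _).trans ?_
      rw [hσ0 _ hx]
      nlinarith
  have hP : ∀ x, segmentGauge L a v x ≤ 0 → ‖transverse L a v x‖ ≤ 0 := fun x hx =>
    (norm_transverse_le x).trans hx
  have hD : ∀ x, segmentGauge L a v x ≤ 0 → segmentGauge L a v (compress L a v σ η x) ≤ 1 :=
    fun x hx => (segmentGauge_compress_le hL hσ hη hη1 x).trans (hx.trans zero_le_one)
  refine hunif _ _ (hD x hx) (hD x' hx') ?_
  refine (dist_le_of_transverse (L := L) (a := a) (v := v) _ _).trans_lt ?_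
  rw [transverse_compress hL, coord_compress hL, transverse_compress hL, coord_compress hL]
  have h1 := hF x hx
  have h2 := hF x' hx'
  have h3 : |compressedCoord L a v σ η x - compressedCoord L a v σ η x'| ≤ 2 * η :=
    abs_le.2 ⟨by linarith, by linarith⟩
  have := mul_le_mul_of_nonneg_right h3 (norm_nonneg v)
  have : 0 ≤ η * ‖v‖ := by positivity
  linarith [hP x hx, hP x' hx']

end

end Compression

/-! ### Shrinking a fibre inside a chart -/

section Transplant

open Set Filter Topology

/-- A continuous permutation which is the identity off a compact set is a homeomorphism. -/
theorem isHomeomorph_of_eq_id_off_compact {M : Type*} [TopologicalSpace M] [T2Space M] {f : M → M}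
    (hf : Continuous f) (hbij : Function.Bijective f) {C : Set M} (hC : IsCompact C)
    (hid : ∀ x ∉ C, f x = x) : IsHomeomorph f := by
  refine isHomeomorph_iff_continuous_isClosedMap_bijective.2 ⟨hf, fun F hF => ?_, hbij⟩
  have hcl : ∀ x ∈ closure Cᶜ, f x = x := fun x hx =>
    (EqOn.closure (f := f) (g := id) hid hf continuous_id) hx
  have e : f '' F = f '' (F ∩ C) ∪ (F ∩ closure Cᶜ) := by
    ext y
    constructor
    · rintro ⟨x, hx, rfl⟩
      by_cases hxC : x ∈ C
      · exact Or.inl ⟨x, ⟨hx, hxC⟩, rfl⟩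
      · rw [hid x hxC]
        exact Or.inr ⟨hx, subset_closure hxC⟩
    · rintro (⟨x, hx, rfl⟩ | ⟨hy, hy'⟩)
      · exact ⟨x, hx.1, rfl⟩
      · exact ⟨y, hy, hcl y hy'⟩
  rw [e]
  exact ((hC.inter_left hF).image hf).isClosed.union (hF.inter isClosed_closure)

/-- A continuous permutation of `E` which is the identity off a compact set extends by the identity
along an embedding of `E` whose range is a neighbourhood of the image of that set. -/
theorem exists_homeomorph_extension {E M : Type*} [TopologicalSpace E] [TopologicalSpace M]
    [T2Space M] {χ : E → M} (hχ : IsEmbedding χ) {h : E → E} (hh : Continuous h)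
    (hbij : Function.Bijective h) {D : Set E} (hD : IsCompact D) (hid : ∀ x ∉ D, h x = x)
    (hrange : ∀ x ∈ D, range χ ∈ 𝓝 (χ x)) :
    ∃ s : M ≃ₜ M, (∀ x, s (χ x) = χ (h x)) ∧ ∀ x ∉ χ '' D, s x = x := by
  let S : Equiv.Perm M :=
    Equiv.Perm.viaEmbedding (Equiv.ofBijective h hbij) ⟨χ, hχ.injective⟩
  have hS : ∀ x, S (χ x) = χ (h x) := fun x =>
    Equiv.Perm.viaEmbedding_apply (Equiv.ofBijective h hbij) ⟨χ, hχ.injective⟩ x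
  have hS' : ∀ x ∉ χ '' D, S x = x := by
    intro x hx
    by_cases hr : x ∈ range χ
    · obtain ⟨u, rfl⟩ := hr
      rw [hS, hid u fun hu => hx ⟨u, hu, rfl⟩]
    · exact Equiv.Perm.viaEmbedding_apply_of_notMem (Equiv.ofBijective h hbij)
        ⟨χ, hχ.injective⟩ x hr
  have hC : IsCompact (χ '' D) := hD.image hχ.continuous
  have hcont : Continuous S := by
    rw [continuous_iff_continuousAt]
    intro x
    by_cases hx : x ∈ χ '' D
    · obtain ⟨u, hu, rfl⟩ := hx
      rw [ContinuousAt, ← hχ.map_nhds_of_mem u (hrange u hu), tendsto_map'_iff, hS]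
      exact ((hχ.continuous.comp hh).tendsto u).congr fun z => (hS z).symm
    · refine continuousAt_id.congr ?_
      filter_upwards [hC.isClosed.isOpen_compl.mem_nhds hx] with z hz
      exact (hS' z hz).symm
  exact ⟨(isHomeomorph_of_eq_id_off_compact hcont S.bijective hC hS').homeomorph, hS, hS'⟩

/-- Shrinking of a fibre which is a straight segment in a Euclidean chart. -/
theorem exists_homeomorph_shrinking_segment {E M Y N : Type*} [NormedAddCommGroup E]
    [NormedSpace ℝ E] [FiniteDimensional ℝ E] [TopologicalSpace M] [T2Space M]
    [TopologicalSpace Y] [PseudoMetricSpace N] {π : M → Y} (hcl : IsClosedMap π)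
    (hcont : Continuous π) (hconn : ∀ y, IsPreconnected (π ⁻¹' {y}))
    {χ : E → M} (hχ : IsEmbedding χ) {a b : E} (hab : a ≠ b) {y : Y}
    (hy : χ '' segment ℝ a b = π ⁻¹' {y}) {W : Set M} (hW : IsOpen W) (hyW : π ⁻¹' {y} ⊆ W)
    (hWχ : W ⊆ range χ) {φ : M → N} (hφ : Continuous φ) {ε : ℝ} (hε : 0 < ε) :
    ∃ s : M ≃ₜ M, (∀ x ∉ W, s x = x) ∧
      (∀ x x', π x = y → π x' = y → dist (φ (s x)) (φ (s x')) ≤ ε) ∧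
      ∀ (z : Y) (d : ℝ), (∀ x x', π x = z → π x' = z → dist (φ x) (φ x') ≤ d) →
        ∀ x x', π x = z → π x' = z → dist (φ (s x)) (φ (s x')) ≤ d + ε := by
  obtain ⟨v, rfl⟩ : ∃ v, b = a + v := ⟨b - a, by abel⟩
  have hv : v ≠ 0 := fun h => hab (by simp [h])
  obtain ⟨L, hL⟩ := SeparatingDual.exists_eq_one (R := ℝ) hv
  set ρ : E → ℝ := segmentGauge L a v with hρ
  have hρc : Continuous ρ := continuous_segmentGauge
  have hseg : ∀ x, ρ x ≤ 0 ↔ π (χ x) = y := by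
    intro x
    have h1 : π (χ x) = y ↔ χ x ∈ χ '' segment ℝ a (a + v) := by rw [hy]; rfl
    rw [hρ, segmentGauge_le_zero_iff hL, h1, hχ.injective.mem_set_image]
  obtain ⟨R, hR, hRW⟩ := exists_segmentGauge_le_subset hL (hW.preimage hχ.continuous)
    (fun x hx => hyW (hy ▸ mem_image_of_mem χ hx))
  have hRW' : ∀ x, ρ x ≤ R → χ x ∈ W := hRW
  -- Upper semicontinuity, in terms of the gauge.
  have hsep : ∀ r > 0, ∃ r' > 0, r' ≤ r ∧ ∀ x, ρ x ≤ r' →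
      π ⁻¹' {π (χ x)} ⊆ χ '' {u | ρ u < r} := by
    intro r hr
    obtain ⟨V, hV, hVr⟩ : ∃ V : Set M, IsOpen V ∧ χ ⁻¹' V = {u | ρ u < min r R} :=
      hχ.isInducing.isOpen_iff.1 (isOpen_lt hρc continuous_const)
    have hVr' : ∀ u, χ u ∈ V ↔ ρ u < min r R := fun u => by
      rw [← mem_preimage, hVr]; rfl
    have hO := isClosedMap_iff_kernImage.1 hcl (hV.inter hW)
    have hyO : y ∈ kernImage π (V ∩ W) := by
      intro x hx
      obtain ⟨u, hu, rfl⟩ : x ∈ χ '' segment ℝ a (a + v) := by rw [hy]; exact hx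
      exact ⟨(hVr' u).2 (((hseg u).2 hx).trans_lt (lt_min hr hR)), hyW hx⟩
    obtain ⟨r', hr', h⟩ := exists_segmentGauge_le_subset hL
      (hO.preimage (hcont.comp hχ.continuous)) (fun x hx => by
        have : π (χ x) = y := (hseg x).1 ((segmentGauge_le_zero_iff hL x).2 hx)
        simpa [this] using hyO)
    refine ⟨min r' r, lt_min hr' hr, min_le_right _ _, fun x hx w hw => ?_⟩
    obtain ⟨hwV, hwW⟩ := h x (hx.trans (min_le_left _ _)) hw
    obtain ⟨u, rfl⟩ := hWχ hwW
    exact ⟨u, ((hVr' u).1 hwV).trans_le (min_le_left _ _), rfl⟩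
  have hsepE : ∀ r > 0, ∃ r' > 0, r' ≤ r ∧ ∀ x x', π (χ x) = π (χ x') → ρ x ≤ r' → ρ x' < r := by
    intro r hr
    obtain ⟨r', hr', hle, h⟩ := hsep r hr
    refine ⟨r', hr', hle, fun x x' hxx hx => ?_⟩
    obtain ⟨u, hu, hux⟩ := h x hx (show π (χ x') = π (χ x) from hxx.symm)
    rwa [← hχ.injective hux]
  -- The scale `lam` on which `φ` is almost constant, and the thickness `τ` adapted to it.
  obtain ⟨lam, hlam, hunif⟩ : ∃ lam > 0, ∀ x x', ρ x ≤ 1 → ρ x' ≤ 1 → dist x x' < lam →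
      dist (φ (χ x)) (φ (χ x')) < ε / 2 := by
    have h := (isCompact_segmentGauge_le (L := L) (a := a) (v := v)
      1).uniformContinuousOn_of_continuous (hφ.comp hχ.continuous).continuousOn
    obtain ⟨lam, hlam, h⟩ := Metric.uniformContinuousOn_iff.1 h (ε / 2) (half_pos hε)
    exact ⟨lam, hlam, fun x x' hx hx' => h x hx x' hx'⟩
  obtain ⟨τ, hτ, hτ1, hτR, hτlam⟩ : ∃ τ > 0, τ ≤ 1 ∧ τ ≤ R ∧ τ * (2 + 10 * ‖v‖) < lam := by
    have hpos : 0 < 2 + 10 * ‖v‖ := by positivity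
    refine ⟨min 1 (min R (lam / (2 + 10 * ‖v‖) / 2)), by positivity, min_le_left _ _,
      (min_le_right _ _).trans (min_le_left _ _), ?_⟩
    rw [← lt_div_iff₀ hpos]
    exact ((min_le_right _ _).trans (min_le_right _ _)).trans_lt (half_lt_self (by positivity))
  obtain ⟨r₁, hr₁, hr₁τ, hr₁s⟩ := hsep τ hτ
  obtain ⟨σ, hσc, hσm, hσ0, hσ1, hσosc⟩ :=
    exists_slow_transition (κ := π ∘ χ) (ρ := ρ) hsepE hr₁ hτ
  have hσn : ∀ t, 0 ≤ σ t := fun t => by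
    rw [← hσ0 (min t 0) (min_le_right _ _)]
    exact hσm (min_le_left _ _)
  have hbij := bijective_compress (a := a) hL hσc hσn hσm
    (fun t ht => hσ1 t (by linarith)) hτ hτ1
  have hid : ∀ x, r₁ ≤ ρ x → compress L a v σ τ x = x := by
    intro x hx
    rw [compress, compressedCoord_eq_of_one hσn hτ hτ1 (hσ1 _ hx), sub_self, zero_smul, add_zero]
  obtain ⟨s, hs, hs'⟩ := exists_homeomorph_extension hχ (continuous_compress hσc) hbij
    (isCompact_segmentGauge_le (L := L) (a := a) (v := v) r₁)
    (fun x hx => hid x (not_le.1 hx).le)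
    (fun x hx => mem_of_superset (hW.mem_nhds (hRW' x (le_trans hx (by linarith)))) hWχ)
  refine ⟨s, fun x hx => hs' x ?_, fun x x' hx hx' => ?_, fun z d hd x x' hx hx' => ?_⟩
  · rintro ⟨u, hu, rfl⟩
    exact hx (hRW' u (le_trans hu (by linarith)))
  · obtain ⟨u, rfl⟩ := hWχ (hyW hx)
    obtain ⟨u', rfl⟩ := hWχ (hyW hx')
    rw [hs, hs]
    have := dist_compress_segment_lt (κ := φ ∘ χ) hL hσn hσ0 hτ hτ1 hτlam hunif
      ((hseg u).2 hx) ((hseg u').2 hx')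
    exact this.le.trans (by linarith)
  · by_cases hz : ∃ u, π (χ u) = z ∧ ρ u ≤ r₁
    · -- The fibre lies in the thin neighbourhood of the segment.
      obtain ⟨u₀, rfl, hu₀⟩ := hz
      have hsub := hr₁s u₀ hu₀
      obtain ⟨u, hu, rfl⟩ := hsub hx
      obtain ⟨u', hu', rfl⟩ := hsub hx'
      rw [hs, hs]
      have hT : IsPreconnected {w | π (χ w) = π (χ u₀)} := by
        rw [← hχ.isInducing.isPreconnected_image]
        convert hconn (π (χ u₀)) using 1
        ext w
        constructor
        · rintro ⟨w, hw, rfl⟩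
          exact hw
        · intro hw
          obtain ⟨w, -, rfl⟩ := hsub hw
          exact ⟨w, hw, rfl⟩
      refine dist_compress_le (κ := φ ∘ χ) hL hσn hτ hτ1 hτ1 le_rfl hτlam hunif hT
        (fun w hw => ?_) (fun w hw => hσosc w u₀ hw) (fun w hw w' hw' => hd _ _ hw hw') hx hx'
      obtain ⟨w', hw', h⟩ := hsub hw
      rw [← hχ.injective h]
      exact hw'.le
    · -- The fibre avoids the support of `s`.
      push Not at hz
      have hfix : ∀ x, π x = z → s x = x := by
        intro x hx
        refine hs' x ?_
        rintro ⟨u, hu, rfl⟩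
        exact (hz u hx).not_ge hu
      rw [hfix x hx, hfix x' hx']
      linarith [hd x x' hx hx']

end Transplant

/-! ### Essentially flat arcs and upper semicontinuous decompositions -/

section Decomposition

open Set Filter Topology

theorem IsArc.isCompact {X : Type*} [TopologicalSpace X] {A : Set X} (hA : IsArc A) :
    IsCompact A := by
  obtain ⟨e⟩ := hA
  have := e.symm.compactSpace
  exact isCompact_iff_compactSpace.2 this

theorem IsArc.isPreconnected {X : Type*} [TopologicalSpace X] {A : Set X} (hA : IsArc A) :
    IsPreconnected A := by
  obtain ⟨e⟩ := hA
  have : PreconnectedSpace (Icc (0 : ℝ) 1) := Subtype.preconnectedSpace isPreconnected_Icc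
  have h := isPreconnected_range (continuous_subtype_val.comp e.symm.continuous)
  rwa [e.symm.surjective.range_comp, Subtype.range_coe] at h

/-- An essentially flat arc is a straight segment in a chart with values in the whole Euclidean
space. The range of the chart is only known to be a neighbourhood of the arc. -/
theorem IsEssentiallyFlatArc.exists_chart {n : ℕ} {M : Type*} [TopologicalSpace M] {A : Set M}
    (hA : IsEssentiallyFlatArc n A) :
    ∃ (χ : EuclideanSpace ℝ (Fin n) → M) (a b : EuclideanSpace ℝ (Fin n)) (O : Set M),
      IsEmbedding χ ∧ a ≠ b ∧ χ '' segment ℝ a b = A ∧ IsOpen O ∧ A ⊆ O ∧ O ⊆ range χ := by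
  obtain ⟨-, U, ⟨O, hO, hAO, hOU⟩, ψ, θ, a, b, hab, hseg⟩ := hA
  refine ⟨fun x => (ψ.symm (θ.symm x) : M), a, b, O,
    IsEmbedding.subtypeVal.comp (ψ.symm.isEmbedding.comp θ.symm.isEmbedding), hab, ?_, hO, hAO, ?_⟩
  · rw [← hseg]
    ext x
    constructor
    · rintro ⟨_, ⟨_, ⟨u, hu, rfl⟩, rfl⟩, rfl⟩
      simpa using hu
    · intro hx
      exact ⟨_, ⟨_, ⟨⟨x, hOU (hAO hx)⟩, hx, rfl⟩, rfl⟩, by simp⟩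
  · intro x hx
    exact ⟨θ (ψ ⟨x, hOU hx⟩), by simp⟩

theorem mk_preimage_mem_classes {X : Type*} (G : Setoid X) (y : Quotient G) :
    Quotient.mk G ⁻¹' {y} ∈ G.classes := by
  induction y using Quotient.inductionOn with
  | h x =>
    refine ⟨x, ?_⟩
    ext z
    exact Quotient.eq

theorem IsUpperSemicontinuousDecomposition.isClosedMap_mk {X : Type*} [TopologicalSpace X]
    {G : Setoid X} (hG : IsUpperSemicontinuousDecomposition G) :
    IsClosedMap (Quotient.mk G) := by
  rw [isClosedMap_iff_kernImage]
  intro U hU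
  refine isOpen_iff_mem_nhds.2 fun y hy => ?_
  -- The set of points whose class lies in `U` is open and saturated.
  have hopen : IsOpen (Quotient.mk G ⁻¹' kernImage (Quotient.mk G) U) := by
    rw [isOpen_iff_mem_nhds]
    intro x hx
    obtain ⟨-, h⟩ := hG _ (mk_preimage_mem_classes G (Quotient.mk G x))
    obtain ⟨V, hV, hxV, -, hVU⟩ := h U hU fun z hz => hx hz
    refine mem_of_superset (hV.mem_nhds (hxV rfl)) fun z hz w hw => ?_
    exact hVU _ (mk_preimage_mem_classes G (Quotient.mk G z)) ⟨z, rfl, hz⟩ hw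
  exact IsOpen.mem_nhds (isQuotientMap_quot_mk.isOpen_preimage.1 hopen) hy

end Decomposition

theorem theorem2p2 (n : ℕ) (M : Type*) [TopologicalSpace M] [T2Space M]
    [SecondCountableTopology M] [ChartedSpace (EuclideanSpace ℝ (Fin n)) M]
    (G : Setoid M) (husc : IsUpperSemicontinuousDecomposition G)
    (𝒜 : Set (Set M)) (hcount : 𝒜.Countable)
    (hflat : ∀ A ∈ 𝒜, IsEssentiallyFlatArc n A)
    (hG : ∀ g ∈ G.classes, (∃ x : M, g = {x}) ∨ g ∈ 𝒜) :
    Nonempty (Quotient G ≃ₜ M) := by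
  have hlc : LocallyCompactSpace M :=
    ChartedSpace.locallyCompactSpace (EuclideanSpace ℝ (Fin n)) M
  have hcl := husc.isClosedMap_mk
  have hcont : Continuous (Quotient.mk G) := continuous_quot_mk
  have hsurj : Function.Surjective (Quotient.mk G) := Quotient.mk_surjective
  have hcases : ∀ y, (∃ x : M, Quotient.mk G ⁻¹' {y} = {x}) ∨ Quotient.mk G ⁻¹' {y} ∈ 𝒜 :=
    fun y => hG _ (mk_preimage_mem_classes G y)
  have hfib : ∀ y, IsCompact (Quotient.mk G ⁻¹' {y}) := by
    intro y
    rcases hcases y with ⟨x, hx⟩ | h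
    · rw [hx]
      exact isCompact_singleton
    · exact (hflat _ h).1.isCompact
  have hconn : ∀ y, IsPreconnected (Quotient.mk G ⁻¹' {y}) := by
    intro y
    rcases hcases y with ⟨x, hx⟩ | h
    · rw [hx]
      exact isPreconnected_singleton
    · exact (hflat _ h).1.isPreconnected
  have hnondeg : {y | ¬ (Quotient.mk G ⁻¹' {y}).Subsingleton}.Countable := by
    refine (hcount.preimage_of_injOn (f := fun y => Quotient.mk G ⁻¹' {y}) ?_).mono ?_
    · exact (hsurj.preimage_injective.comp Set.singleton_injective).injOn
    · intro y hy
      rcases hcases y with ⟨x, hx⟩ | h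
      · exact absurd (hx ▸ Set.subsingleton_singleton) hy
      · exact h
  have ht2 : T2Space (Quotient G) := hcl.t2Space_of_isCompact_fiber hsurj hfib
  have hsc : SecondCountableTopology (Quotient G) :=
    hcl.secondCountableTopology_of_isCompact_fiber hcont hsurj hfib
  have hwlc : WeaklyLocallyCompactSpace (Quotient G) :=
    hcl.weaklyLocallyCompactSpace_of_isCompact_fiber hcont hsurj hfib
  have := isCompletelyMetrizableSpace_of_locallyCompact M
  have := isCompletelyMetrizableSpace_of_locallyCompact (Quotient G)
  let := TopologicalSpace.upgradeIsCompletelyMetrizable M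
  let := TopologicalSpace.upgradeIsCompletelyMetrizable (Quotient G)
  have hshrink : HasShrinkableFibers M (Quotient.mk G) := by
    intro y W hW hyW φ hφ ε hε
    rcases hcases y with ⟨x₀, hx₀⟩ | h
    · have hy : ∀ x, Quotient.mk G x = y → x = x₀ := fun x hx => by
        have : x ∈ Quotient.mk G ⁻¹' {y} := hx
        rwa [hx₀] at this
      refine ⟨Homeomorph.refl M, fun _ _ => rfl, fun x x' hx hx' => ?_, fun z d hd x x' hx hx' => ?_⟩
      · rw [hy x hx, hy x' hx', dist_self]
        exact hε.le
      · exact (hd x x' hx hx').trans (by linarith)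
    · obtain ⟨χ, a, b, O, hχ, hab, hseg, hO, hyO, hOχ⟩ := (hflat _ h).exists_chart
      obtain ⟨s, hs, hs'⟩ := exists_homeomorph_shrinking_segment hcl hcont hconn hχ hab hseg
        (hW.inter hO) (Set.subset_inter hyW hyO) (Set.inter_subset_right.trans hOχ) hφ hε
      exact ⟨s, fun x hx => hs x fun hx' => hx hx'.1, hs'⟩
  obtain ⟨e⟩ := hshrink.nonempty_homeomorph hcont hcl hsurj hfib hnondeg
  exact ⟨e.symm⟩
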